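/- Let $c^*>0$ and let $g:\mathbb{R}\to\mathbb{R}$ be a continuous, strictly increasing function with $g(0)=0$ and $g(c^*)+1=c^*$, and suppose there is $\kappa<1$ such that $|g(x)-g(y)|\le\kappa|x-y|$ for all $x,y\in(0,c^*)$. For $c\in(0,c^*)$ let $T_c$ be the transformation of the interval $[g(c),g(c)+1]$ given by $$T_c(x)=\begin{cases} g(x)+1 & (x<c),\\ g(x) & (x\ge c).\end{cases}$$ For $0<\alpha,\beta<1$ let $S_{\alpha,\beta}(x)=\alpha x+\beta \pmod 1$ on $[0,1]$, with values in $[0,1)$. For integers $n\ge 2$ and $0\le l<n$ with $\gcd(n,l)=1$, put $k_m=\lfloor (m+1)l/n\rfloor-\lfloor ml/n\rfloor$, $$B^U_{n,l}(\alpha)=(1-\alpha)\Bigl(\frac{1}{1-\alpha^n}\sum_{m=1}^{n-1}k_m\alpha^m+1\Bigr),\qquad B^L_{n,l}(\alpha)=(1-\alpha)\Bigl(\frac{1}{1-\alpha^n}\sum_{m=1}^{n-1}k_m\alpha^m+1-\frac{\alpha^{n-1}-\alpha^n}{1-\alpha^n}\Bigr),$$ and $D_{n,l}=\{(\alpha,\beta)\in(0,1)^2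 : B^L_{n,l}(\alpha)\le\beta<B^U_{n,l}(\alpha)\}$. Then there exist $c^L_{n,l},c^R_{n,l}\in(0,c^*)$ with $c^L_{n,l}<c^R_{n,l}$, for all integers $n\ge2$ and $0\le l<n$ with $\gcd(n,l)=1$, such that: (i) for every such $(n,l)$ and every $c\in(c^L_{n,l},c^R_{n,l})$ there is $(\alpha,\beta)$ in the interior of $D_{n,l}$ such that $T_c$ on $[g(c),g(c)+1]$ is topologically conjugate (by a homeomorphism) to $S_{\alpha,\beta}$ on $[0,1]$; (ii) for all such pairs $(n,l)$ and $(n',l')$ with $n'l-nl'=1$, $$c^R_{n,l}<c^L_{n+n',l+l'}<c^R_{n+n',l+l'}<c^L_{n',l'}.$$ -/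

import Mathlib

noncomputable section

namespace NagumoSato

/-- The linear contracting map `S_{α,β}(x) = α x + β (mod 1)`, considered on `[0,1]`. -/
def S (α β : ℝ) (x : ℝ) : ℝ := Int.fract (α * x + β)

/-- The rational characteristic sequence of `(n,l)`: `k_m = [(m+1)l/n] - [ml/n]` for `m ∈ ℤ`. -/
def k (n l : ℕ) (m : ℤ) : ℤ :=
  ⌊(((m + 1) * l : ℤ) : ℚ) / (n : ℚ)⌋ - ⌊((m * l : ℤ) : ℚ) / (n : ℚ)⌋

/-- The upper boundary function `B^U_{n,l}(α)`. -/
def BU (n l : ℕ) (α : ℝ) : ℝ :=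
  (1 - α) * (1 / (1 - α ^ n) * (∑ m ∈ Finset.Icc 1 (n - 1), (k n l m : ℝ) * α ^ m) + 1)

/-- The lower boundary function `B^L_{n,l}(α)`. -/
def BL (n l : ℕ) (α : ℝ) : ℝ :=
  (1 - α) * (1 / (1 - α ^ n) * (∑ m ∈ Finset.Icc 1 (n - 1), (k n l m : ℝ) * α ^ m) + 1
    - (α ^ (n - 1) - α ^ n) / (1 - α ^ n))

/-- The parameter region `D_{n,l} ⊆ (0,1)²`. -/
def D (n l : ℕ) : Set (ℝ × ℝ) :=
  {p | p.1 ∈ Set.Ioo (0 : ℝ) 1 ∧ p.2 ∈ Set.Ioo (0 : ℝ) 1 ∧ BL n l p.1 ≤ p.2 ∧ p.2 < BU n l p.1}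

/-- The map `T_c`, equal to `h = g + 1` on `x < c` and to `g` on `x ≥ c`. -/
def T (g : ℝ → ℝ) (c : ℝ) (x : ℝ) : ℝ := if x < c then g x + 1 else g x

/-- `f` is a transformation of `A`, `s` is a transformation of `B`, and these two transformations
are topologically conjugate: `H ∘ f = s ∘ H` for some homeomorphism `H : A → B`. -/
def ConjugateOn {X Y : Type*} [TopologicalSpace X] [TopologicalSpace Y]
    (f : X → X) (A : Set X) (s : Y → Y) (B : Set Y) : Prop :=
  ∃ (hf : Set.MapsTo f A A) (hs : Set.MapsTo s B B) (H : A ≃ₜ B),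
    Function.Semiconj H (hf.restrict f A A) (hs.restrict s B B)

end NagumoSato

end

/-! A periodic orbit of rotation number `l / n` depends on `c` only through which of its points lie
left of `c`. Requiring that the lowest `n - l` of `n` ordered points move by `g + 1` and the others
by `g` gives a fixed-point problem free of `c`, solved by contraction in `exists_rotationOrbit`. The
solution is an orbit of `T_c` whenever `c` lies strictly between `u (n - l - 1)` and `u (n - l)`;
these are the endpoints `cL` and `cR`.

For such `c`, `exists_linearization` builds an increasing `H` carrying both branches of `T_c` to
affine maps of slope `α`, so `T_c` is conjugate to `S α β`. The transported orbit is periodic under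
an affine system, hence explicit (`periodic_affine_eq`): its lowest point being positive says `BL <
β`, its highest being below 1 says `β < BU`.

If two intervals were in the wrong order, the orbit of smaller rotation number would stay above the
faster one forever, which is absurd (`le_of_lt`). This gives a weak inequality; the nondegenerate
interval of a mediant, inserted in between, makes it strict. -/

/-- A continuous strictly increasing map `g` with `g 0 = 0` and `g a + 1 = a` which contracts
distances on `[0, a]` by the factor `κ < 1`. -/
structure IsContractionOn (g : ℝ → ℝ) (a κ : ℝ) : Prop where
  pos : 0 < a
  cont : Continuous g
  mono : StrictMono g
  zero : g 0 = 0
  top : g a + 1 = a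
  lt_one : κ < 1
  sub_le : ∀ x y, 0 ≤ x → x ≤ y → y ≤ a → g y - g x ≤ κ * (y - x)

/-- The contraction property on an open interval extends to the closed interval. -/
theorem IsContractionOn.of_Ioo {g : ℝ → ℝ} {a κ : ℝ} (ha : 0 < a) (hc : Continuous g)
    (hm : StrictMono g) (h0 : g 0 = 0) (h1 : g a + 1 = a) (hκ : κ < 1)
    (h : ∀ x ∈ Set.Ioo 0 a, ∀ y ∈ Set.Ioo 0 a, |g x - g y| ≤ κ * |x - y|) :
    IsContractionOn g a κ := by
  refine ⟨ha, hc, hm, h0, h1, hκ, fun x y hx hxy hy => ?_⟩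
  have hcl : ∀ p ∈ closure (Set.Ioo 0 a ×ˢ Set.Ioo 0 a), |g p.1 - g p.2| ≤ κ * |p.1 - p.2| := by
    have hclosed : IsClosed {p : ℝ × ℝ | |g p.1 - g p.2| ≤ κ * |p.1 - p.2|} :=
      isClosed_le (by fun_prop) (by fun_prop)
    exact fun p hp => closure_minimal (fun p hp => h p.1 hp.1 p.2 hp.2) hclosed hp
  rw [closure_prod_eq, closure_Ioo ha.ne] at hcl
  have := hcl (y, x) ⟨⟨hx.trans hxy, hy⟩, ⟨hx, hxy.trans hy⟩⟩
  simp only [abs_of_nonneg (sub_nonneg.2 hxy)] at this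
  exact (le_abs_self _).trans this

namespace IsContractionOn

variable {g : ℝ → ℝ} {a κ : ℝ}

theorem factor_pos (F : IsContractionOn g a κ) : 0 < κ := by
  have h1 := F.sub_le 0 a le_rfl F.pos.le le_rfl
  have h2 := F.mono F.pos
  by_contra hk
  nlinarith [F.pos]

theorem sub_lt (F : IsContractionOn g a κ) {x y : ℝ} (hx : 0 ≤ x) (hxy : x < y) (hy : y ≤ a) :
    g y - g x < y - x := by
  have h1 := F.sub_le x y hx hxy.le hy
  nlinarith [F.lt_one]

/-- Increments of `g` are smaller than `q` when increments of the argument are at most `q ≥ 1`. -/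
theorem lt_add (F : IsContractionOn g a κ) {x y q : ℝ} (hx : x ∈ Set.Icc 0 a)
    (hy : y ∈ Set.Icc 0 a) (hq : 0 < q) (h : y ≤ x + q) : g y < g x + q := by
  rcases lt_or_ge x y with hxy | hxy
  · linarith [F.sub_lt hx.1 hxy hy.2]
  · linarith [F.mono.monotone hxy]

theorem nonneg (F : IsContractionOn g a κ) {x : ℝ} (hx : 0 ≤ x) : 0 ≤ g x := by
  rw [← F.zero]; exact F.mono.monotone hx

theorem add_one_le (F : IsContractionOn g a κ) {x : ℝ} (hx : x ≤ a) : g x + 1 ≤ a := by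
  have := F.mono.monotone hx
  linarith [F.top]

theorem apply_lt (F : IsContractionOn g a κ) {c : ℝ} (hc : c ∈ Set.Ioo 0 a) : g c < c := by
  have := F.sub_lt le_rfl hc.1 hc.2.le
  rw [F.zero] at this; linarith

theorem lt_apply_add_one (F : IsContractionOn g a κ) {c : ℝ} (hc : c ∈ Set.Ioo 0 a) :
    c < g c + 1 := by
  have := F.sub_lt hc.1.le hc.2 le_rfl
  linarith [F.top]

theorem apply_pos (F : IsContractionOn g a κ) {c : ℝ} (hc : 0 < c) : 0 < g c := by
  rw [← F.zero]; exact F.mono hc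

theorem apply_add_one_lt (F : IsContractionOn g a κ) {c : ℝ} (hc : c < a) : g c + 1 < a := by
  linarith [F.mono hc, F.top]

end IsContractionOn

/-! ### Periodic orbits with rational rotation number -/

/-- A lift to `ℝ` of a periodic orbit of the system `{g, g + 1}` with rotation number `l / n`. -/
structure IsRotationOrbit (g : ℝ → ℝ) (a : ℝ) (n l : ℕ) (u : ℤ → ℝ) : Prop where
  mono : StrictMono u
  add_period : ∀ r, u (r + n) = u r + 1
  step : ∀ r : ℤ, 0 ≤ r → r < n → u (r + l) = g (u r) + 1
  mem : ∀ r : ℤ, 0 ≤ r → r < n → u r ∈ Set.Ioo 0 a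

/-- The transfer operator on `n` ordered points: the shift by `l` composed with `g`, clamped to
`[0, a]`, with the points which do not wrap around raised by one. -/
def orbitOperator (g : ℝ → ℝ) (a : ℝ) (n l : ℕ) (hl : l ≤ n) (w : Fin n → ℝ) (i : Fin n) : ℝ :=
  if h : l ≤ i then g (max 0 (min a (w ⟨i - l, by omega⟩))) + 1
  else g (max 0 (min a (w ⟨i + (n - l), by omega⟩)))

section Orbit

variable {g : ℝ → ℝ} {a κ : ℝ}

theorem clamp_mem_Icc (ha : 0 ≤ a) (x : ℝ) : max 0 (min a x) ∈ Set.Icc 0 a :=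
  ⟨le_max_left _ _, max_le ha (min_le_left _ _)⟩

theorem clamp_le_add {x y q : ℝ} (hq : 0 ≤ q) (h : x ≤ y + q) :
    max 0 (min a x) ≤ max 0 (min a y) + q := by
  rcases le_total a y with h1 | h1 <;> rcases le_total a x with h2 | h2 <;>
    simp only [min_eq_left, min_eq_right, h1, h2] <;>
    refine max_le (by positivity) ?_
  · linarith [le_max_right 0 a]
  · linarith [le_max_right 0 a]
  · linarith [le_max_right 0 y]
  · linarith [le_max_right 0 y]

/-- Clamping is nonexpansive and lands where `g` contracts, so the orbit operator becomes a
contraction of all of `ℝⁿ`. -/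
theorem IsContractionOn.abs_clamp_le (F : IsContractionOn g a κ) (x y : ℝ) :
    |g (max 0 (min a x)) - g (max 0 (min a y))| ≤ κ * |x - y| := by
  wlog hxy : x ≤ y generalizing x y
  · rw [abs_sub_comm, abs_sub_comm x]; exact this y x (le_of_not_ge hxy)
  have h1 : max 0 (min a x) ≤ max 0 (min a y) := max_le_max le_rfl (min_le_min le_rfl hxy)
  have h2 : max 0 (min a y) ≤ max 0 (min a x) + (y - x) :=
    clamp_le_add (sub_nonneg.2 hxy) (by linarith)
  have h3 := F.sub_le _ _ (clamp_mem_Icc F.pos.le x).1 h1 (clamp_mem_Icc F.pos.le y).2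
  rw [abs_sub_comm, abs_sub_comm x, abs_of_nonneg (sub_nonneg.2 (F.mono.monotone h1)),
    abs_of_nonneg (sub_nonneg.2 hxy)]
  nlinarith [F.factor_pos]

theorem IsContractionOn.contracting_orbitOperator (F : IsContractionOn g a κ) (n l : ℕ)
    (hl : l ≤ n) : ContractingWith ⟨κ, F.factor_pos.le⟩ (orbitOperator g a n l hl) := by
  refine ⟨F.lt_one, LipschitzWith.of_dist_le_mul fun w v => ?_⟩
  have hκ := F.factor_pos.le
  refine (dist_pi_le_iff (by positivity)).2 fun i => ?_
  have key : ∀ j : Fin n, κ * |w j - v j| ≤ κ * dist w v := fun j =>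
    mul_le_mul_of_nonneg_left (by rw [← Real.dist_eq]; exact dist_le_pi_dist w v j) hκ
  unfold orbitOperator
  rw [Real.dist_eq]
  split_ifs
  · rw [add_sub_add_right_eq_sub]
    exact (F.abs_clamp_le _ _).trans (key _)
  · exact (F.abs_clamp_le _ _).trans (key _)

/-- The ordered configurations of `n` points of diameter at most one. -/
def orderedConfig (n : ℕ) : Set (Fin n → ℝ) := {w | Monotone w ∧ ∀ i j, w i ≤ w j + 1}

theorem isClosed_orderedConfig (n : ℕ) : IsClosed (orderedConfig n) := by
  have : orderedConfig n =
      (⋂ i, ⋂ j, ⋂ _ : i ≤ j, {w | w i ≤ w j}) ∩ ⋂ i, ⋂ j, {w : Fin n → ℝ | w i ≤ w j + 1} := by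
    ext w
    simp [orderedConfig, Monotone]
  rw [this]
  refine IsClosed.inter ?_ ?_
  · exact isClosed_iInter fun i => isClosed_iInter fun j => isClosed_iInter fun _ =>
      isClosed_le (by fun_prop) (by fun_prop)
  · exact isClosed_iInter fun i => isClosed_iInter fun j =>
      isClosed_le (by fun_prop) (by fun_prop)

/-- The two conditions feed each other: order across the cut at `l` comes from the diameter bound,
and the diameter bound across it comes from monotonicity. -/
theorem IsContractionOn.mapsTo_orbitOperator (F : IsContractionOn g a κ) (n l : ℕ) (hl : l ≤ n) :
    Set.MapsTo (orbitOperator g a n l hl) (orderedConfig n) (orderedConfig n) := by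
  intro w hw
  have hmono : ∀ i j : Fin n, i ≤ j →
      g (max 0 (min a (w i))) ≤ g (max 0 (min a (w j))) := fun i j hij =>
    F.mono.monotone (max_le_max le_rfl (min_le_min le_rfl (hw.1 hij)))
  have hone : ∀ i j : Fin n, g (max 0 (min a (w i))) ≤ g (max 0 (min a (w j))) + 1 := fun i j =>
    (F.lt_add (clamp_mem_Icc F.pos.le _) (clamp_mem_Icc F.pos.le _) one_pos
      (clamp_le_add zero_le_one (hw.2 i j))).le
  constructor
  · intro i j hij
    have hij' : (i : ℕ) ≤ j := hij
    unfold orbitOperator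
    split_ifs with h1 h2 h2
    · exact add_le_add_left (hmono _ _ (Fin.mk_le_mk.2 (by omega))) 1
    · omega
    · exact hone _ _
    · exact hmono _ _ (Fin.mk_le_mk.2 (by omega))
  · intro i j
    unfold orbitOperator
    split_ifs with h1 h2 h2
    · linarith [hone ⟨i - l, by omega⟩ ⟨j - l, by omega⟩]
    · exact add_le_add_left (hmono _ _ (Fin.mk_le_mk.2 (by omega))) 1
    · linarith [hone ⟨i + (n - l), by omega⟩ ⟨j - l, by omega⟩]
    · exact hone _ _

/-- A strictly monotone lift is forced by strictness at one place, coprimality and equivariance. -/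
theorem strictMono_of_step (F : IsContractionOn g a κ) {n l : ℕ} (hn : 0 < n)
    (hnl : Nat.Coprime n l) {u : ℤ → ℝ} (hu : Monotone u) (hadd : ∀ r, u (r + n) = u r + 1)
    (hstep : ∀ r : ℤ, 0 ≤ r → r < n → u (r + l) = g (u r) + 1)
    (hmem : ∀ r : ℤ, 0 ≤ r → r < n → u r ∈ Set.Icc 0 a) : StrictMono u := by
  have haddmul : ∀ (q r : ℤ), u (r + q * n) = u r + q := by
    intro q
    induction q using Int.induction_on with
    | zero => simp
    | succ i ih => intro r; rw [add_mul, one_mul, ← add_assoc, hadd, ih]; push_cast; ring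
    | pred i ih =>
      intro r
      have := hadd (r + (-i - 1) * n)
      rw [show r + (-(i:ℤ) - 1) * n + n = r + -i * n by ring, ih] at this
      push_cast at this ⊢; linarith
  have hn' : (0 : ℤ) < n := by exact_mod_cast hn
  -- At the seam strictness is automatic: `u (n - 1) ≤ u 0 + 1`, and `g` shrinks a gap of at most 1
  -- to less than 1.
  have hlast : u ((n - 1 : ℤ) + l) < u ((n - 1 : ℤ) + l + 1) := by
    have h0 := hmem 0 le_rfl hn'
    have h1 := hmem (n - 1) (by omega) (by omega)
    have e1 := hstep 0 le_rfl hn'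
    have e2 := hstep (n - 1) (by omega) (by omega)
    have e3 := hadd (0 + l)
    have e4 := hadd 0
    have h2 : u (n - 1) ≤ u 0 + 1 := by rw [← e4]; exact hu (by omega)
    have := F.lt_add h0 h1 one_pos h2
    rw [show (n - 1 : ℤ) + l + 1 = 0 + l + n by ring, e3, e1, e2]
    linarith
  have hnext : ∀ r, u r < u (r + 1) → u (r + l) < u (r + l + 1) := by
    intro r hr
    set r0 := r % n with hr0
    set q := r / n with hq
    have hr' : r = r0 + q * n := by
      have := Int.emod_add_mul_ediv r n
      rw [hr0, hq]; linarith
    have h0 : 0 ≤ r0 := Int.emod_nonneg _ hn'.ne'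
    have h1 : r0 < n := Int.emod_lt_of_pos _ hn'
    rw [hr', show r0 + q * n + 1 = (r0 + 1) + q * n by ring, haddmul, haddmul] at hr
    rw [hr', show r0 + q * n + l + 1 = (r0 + l + 1) + q * n by ring,
      show r0 + q * n + l = (r0 + l) + q * n by ring, haddmul, haddmul]
    rcases eq_or_ne r0 (n - 1) with h2 | h2
    · rw [h2]; linarith
    · rw [show r0 + l + 1 = (r0 + 1) + l by ring, hstep _ h0 h1,
        hstep (r0 + 1) (by omega) (by omega)]
      have := F.mono (show u r0 < u (r0 + 1) by linarith)
      linarith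
  have hiter : ∀ k : ℕ, u ((n - 1 : ℤ) + l + k * l) < u ((n - 1 : ℤ) + l + k * l + 1) := by
    intro k
    induction k with
    | zero => simpa using hlast
    | succ k ih =>
      have := hnext _ ih
      rw [show (n - 1 : ℤ) + l + (k + 1 : ℕ) * l = (n - 1 : ℤ) + l + k * l + l by push_cast; ring]
      exact this
  refine strictMono_int_of_lt_succ fun r => ?_
  -- By Bézout `l` generates the integers mod `n`, so every adjacent pair is reached from the seam
  -- by steps of `l`, up to a period.
  obtain ⟨k, q, hkq⟩ : ∃ (k : ℕ) (q : ℤ), r = (n - 1 : ℤ) + l + k * l + q * n := by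
    obtain ⟨x, y, hxy⟩ : IsCoprime (n : ℤ) (l : ℤ) := Nat.isCoprime_iff_coprime.2 hnl
    set d := r - (n - 1 : ℤ) - l
    refine ⟨((d * y) % n).toNat, d * x + (d * y) / n * l, ?_⟩
    rw [Int.toNat_of_nonneg (Int.emod_nonneg _ hn'.ne')]
    have h2 := Int.emod_add_mul_ediv (d * y) n
    have h3 : d = d * (x * n + y * l) := by rw [hxy, mul_one]
    have h4 : d * y % n = d * y - n * (d * y / n) := by linarith
    rw [h4]
    have : r = d + (n - 1 : ℤ) + l := by simp only [d]; ring
    linear_combination this + h3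
  rw [hkq, show (n - 1 : ℤ) + l + k * l + q * n + 1 = (n - 1 : ℤ) + l + k * l + 1 + q * n by ring,
    haddmul, haddmul]
  linarith [hiter k]

/-- Every rational rotation number in `(0, 1)` is realized by a periodic orbit. -/
theorem IsContractionOn.exists_rotationOrbit (F : IsContractionOn g a κ) {n l : ℕ} (hl0 : 0 < l)
    (hl : l < n) (hnl : Nat.Coprime n l) : ∃ u, IsRotationOrbit g a n l u := by
  have hC := F.contracting_orbitOperator n l hl.le
  set w := ContractingWith.fixedPoint _ hC with hw
  have hfix : orbitOperator g a n l hl.le w = w := hC.fixedPoint_isFixedPt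
  have hwC : w ∈ orderedConfig n := by
    have h0 : (0 : Fin n → ℝ) ∈ orderedConfig n := ⟨fun _ _ _ => le_rfl, fun i j => by simp⟩
    refine (isClosed_orderedConfig n).mem_of_tendsto (hC.tendsto_iterate_fixedPoint 0) ?_
    exact Filter.Eventually.of_forall fun k => (F.mapsTo_orbitOperator n l hl.le).iterate k h0
  -- A fixed point is a value of the operator, hence lies in `[0, a]`, and the clamps are inactive
  -- on it.
  have hwI : ∀ i, w i ∈ Set.Icc 0 a := by
    intro i
    rw [← hfix]
    unfold orbitOperator
    split_ifs
    · have h := clamp_mem_Icc F.pos.le (w ⟨i - l, by omega⟩)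
      exact ⟨by linarith [F.nonneg h.1], F.add_one_le h.2⟩
    · have h := clamp_mem_Icc F.pos.le (w ⟨i + (n - l), by omega⟩)
      exact ⟨F.nonneg h.1, by linarith [F.add_one_le h.2]⟩
  have hclamp : ∀ i, max 0 (min a (w i)) = w i := fun i => by
    rw [min_eq_right (hwI i).2, max_eq_right (hwI i).1]
  have hn : (0 : ℤ) < n := by omega
  have hlt : ∀ r : ℤ, (r % n).toNat < n := fun r => by
    have := Int.emod_nonneg r hn.ne'
    have := Int.emod_lt_of_pos r hn
    omega
  let u : ℤ → ℝ := fun r => w ⟨(r % n).toNat, hlt r⟩ + ((r / n : ℤ) : ℝ)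
  have hu0 : ∀ (r : ℤ) (i : ℕ) (hi : i < n), r = i → u r = w ⟨i, hi⟩ := by
    intro r i hi hr
    have h1 : r % n = i := by rw [hr]; exact Int.emod_eq_of_lt (by omega) (by omega)
    have h2 : r / n = 0 := by rw [hr]; exact Int.ediv_eq_zero_of_lt (by omega) (by omega)
    simp [u, h1, h2]
  have hadd : ∀ r, u (r + n) = u r + 1 := by
    intro r
    have h1 : (r + n) / n = r / n + 1 := by
      simpa using Int.add_mul_ediv_right r 1 hn.ne'
    simp only [u, Int.add_emod_right, h1]
    push_cast; ring
  have hmem : ∀ r : ℤ, 0 ≤ r → r < n → u r ∈ Set.Icc 0 a := by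
    intro r h0 h1
    rw [hu0 r r.toNat (by omega) (by omega)]
    exact hwI _
  have hstep : ∀ r : ℤ, 0 ≤ r → r < n → u (r + l) = g (u r) + 1 := by
    intro r h0 h1
    obtain ⟨i, rfl⟩ := Int.eq_ofNat_of_zero_le h0
    rw [hu0 i i (by omega) rfl]
    rcases lt_or_ge (i + l) n with h2 | h2
    · rw [hu0 (i + l) (i + l) h2 (by push_cast; ring)]
      conv_lhs => rw [← hfix]
      unfold orbitOperator
      rw [dif_pos (by simp)]
      simp only [hclamp]
      simp
    · have e := hadd (i + l - n)
      rw [sub_add_cancel] at e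
      rw [e, hu0 (i + l - n) (i + l - n) (by omega) (by omega)]
      conv_lhs => rw [← hfix]
      unfold orbitOperator
      rw [dif_neg (by simp; omega)]
      simp only [hclamp]
      have : i + l - n + (n - l) = i := by omega
      simp [this]
  have hmono : Monotone u := by
    refine monotone_int_of_le_succ fun r => ?_
    have h0 := Int.emod_nonneg r hn.ne'
    have h1 := Int.emod_lt_of_pos r hn
    have h2 := Int.emod_add_mul_ediv r n
    rcases lt_or_ge (r % n + 1) n with h3 | h3
    · have e1 : (r + 1) % n = r % n + 1 := by
        rw [← Int.emod_eq_of_lt (by omega) h3, Int.emod_add_emod]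
      have e2 : (r + 1) / n = r / n := by
        have h4 := Int.emod_add_mul_ediv (r + 1) n
        have : (n : ℤ) * ((r + 1) / n) = n * (r / n) := by linarith
        exact mul_left_cancel₀ hn.ne' this
      simp only [u, e2]
      gcongr
      exact hwC.1 (Fin.mk_le_mk.2 (by omega))
    · have e3 : r + 1 = n * (r / n + 1) := by rw [mul_add]; omega
      have e2 : (r + 1) / n = r / n + 1 := by rw [e3, Int.mul_ediv_cancel_left _ hn.ne']
      simp only [u, e2]
      push_cast
      have := hwC.2 ⟨(r % n).toNat, hlt r⟩ ⟨((r + 1) % n).toNat, hlt (r + 1)⟩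
      linarith
  have hstrict := strictMono_of_step F (by omega) hnl hmono hadd hstep hmem
  refine ⟨u, hstrict, hadd, hstep, fun r h0 h1 => ⟨?_, ?_⟩⟩
  -- Strictness moves the orbit off the endpoints: `u 0 = g (u (n - l))` with `u (n - l) > 0`, and
  -- dually at the top.
  · have e1 := hstep (n - l) (by omega) (by omega)
    have e2 := hadd 0
    rw [show (n - l : ℤ) + l = 0 + n by ring, e2] at e1
    have h3 : 0 < u (n - l) :=
      (hmem 0 le_rfl hn).1.trans_lt (hstrict (by omega))
    have := F.apply_pos h3
    have := hmono h0
    linarith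
  · have e1 := hstep (n - 1 - l) (by omega) (by omega)
    rw [sub_add_cancel] at e1
    have h3 : u (n - 1 - l) < a :=
      (hstrict (show (n - 1 - l : ℤ) < n - 1 by omega)).trans_le (hmem _ (by omega) (by omega)).2
    have := F.apply_add_one_lt h3
    have := hmono (show r ≤ n - 1 by omega)
    linarith

end Orbit

/-! ### Ordering of the phase-locking intervals -/

section Comparison

variable {g : ℝ → ℝ} {a κ : ℝ}

theorem IsRotationOrbit.add_mul {n l : ℕ} {u : ℤ → ℝ} (hu : IsRotationOrbit g a n l u)
    (r q : ℤ) : u (r + q * n) = u r + q := by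
  induction q using Int.induction_on with
  | zero => simp
  | succ i ih => rw [_root_.add_mul, one_mul, ← add_assoc, hu.add_period, ih]; push_cast; ring
  | pred i ih =>
    have := hu.add_period (r + (-i - 1) * n)
    rw [show r + (-(i:ℤ) - 1) * n + n = r + -i * n by ring, ih] at this
    push_cast at this ⊢; linarith

theorem IsRotationOrbit.exists_rep {n l : ℕ} {u : ℤ → ℝ} (hu : IsRotationOrbit g a n l u)
    (hn : 0 < n) (r : ℤ) : ∃ r0 q : ℤ, r = r0 + q * n ∧ 0 ≤ r0 ∧ r0 < n ∧ u r = u r0 + q ∧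
      u (r + l) = g (u r0) + 1 + q := by
  have hn' : (0 : ℤ) < n := by exact_mod_cast hn
  have hr : r = r % n + r / n * n := by linarith [Int.emod_add_mul_ediv r n]
  refine ⟨r % n, r / n, hr, Int.emod_nonneg _ hn'.ne', Int.emod_lt_of_pos _ hn', ?_, ?_⟩
  · conv_lhs => rw [hr]
    exact hu.add_mul _ _
  · conv_lhs => rw [hr]
    rw [add_right_comm, hu.add_mul, hu.step _ (Int.emod_nonneg _ hn'.ne')
      (Int.emod_lt_of_pos _ hn')]

/-- The phase-locking intervals are ordered oppositely to their rotation numbers. -/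
theorem IsRotationOrbit.le_of_lt (F : IsContractionOn g a κ) {n l n' l' : ℕ} {u v : ℤ → ℝ}
    (hu : IsRotationOrbit g a n l u) (hv : IsRotationOrbit g a n' l' v)
    (hl0 : 0 < l) (hl : l < n) (hl0' : 0 < l') (hl' : l' < n') (hlt : n * l' < n' * l) :
    u (n - l) ≤ v (n' - l' - 1) := by
  by_contra! hcon
  -- One step of `g + 1` turns the wrong order of the endpoints into a bound on the whole block of
  -- `v`.
  have hgap : v (n' - 1) < u n := by
    have e1 := hu.step (n - l) (by omega) (by omega)
    have e2 := hv.step (n' - l' - 1) (by omega) (by omega)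
    rw [sub_add_cancel] at e1
    rw [show (n' - l' - 1 : ℤ) + l' = n' - 1 by ring] at e2
    linarith [F.mono hcon]
  -- The lifts need not share integer parts `p`, `q`: if `p < q`, `g` shrinks gaps; if `p = q`, `g`
  -- is monotone; `p > q` is what `hgap` excludes.
  have hpres : ∀ i j : ℤ, u j ≤ v i → u (j + l) ≤ v (i + l') := by
    intro i j hij
    obtain ⟨i0, q, hi, h0, h1, e1, e2⟩ := hv.exists_rep (by omega) i
    obtain ⟨j0, p, hj, k0, k1, e3, e4⟩ := hu.exists_rep (by omega) j
    have hv0 := Set.Ioo_subset_Icc_self (hv.mem i0 h0 h1)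
    have hu0 := Set.Ioo_subset_Icc_self (hu.mem j0 k0 k1)
    rw [e2, e4]
    rw [e1, e3] at hij
    rcases lt_trichotomy p q with hpq | hpq | hpq
    · have hpq' : (p : ℝ) < q := by exact_mod_cast hpq
      have := F.lt_add hv0 hu0 (sub_pos.2 hpq') (by linarith)
      linarith
    · rw [hpq] at hij ⊢
      have := F.mono.monotone (show u j0 ≤ v i0 by linarith)
      linarith
    · exfalso
      have hpq' : (q : ℝ) + 1 ≤ p := by exact_mod_cast hpq
      have a1 : v i0 ≤ v (n' - 1) := hv.mono.monotone (by omega)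
      have a2 : u n ≤ u j0 + 1 := by
        rw [← hu.add_period]; exact hu.mono.monotone (by omega)
      linarith
  obtain ⟨K, hK⟩ := exists_int_gt (u 0 - v 0)
  have hiter : ∀ k : ℕ, u (0 + k * l) ≤ v (0 + K * n' + k * l') := by
    intro k
    induction k with
    | zero => simp only [Nat.cast_zero, zero_mul, add_zero]; rw [hv.add_mul]; linarith
    | succ k ih =>
      have := hpres _ _ ih
      push_cast
      rw [show (0 : ℤ) + (k + 1) * l = 0 + k * l + l by ring,
        show (0 : ℤ) + K * n' + (k + 1) * l' = 0 + K * n' + k * l' + l' by ring]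
      exact this
  obtain ⟨N, hN⟩ := exists_nat_gt (v 0 + K - u 0)
  -- After a common multiple of both periods `u` has gained `N * n' * l` and `v` only `N * n * l'`.
  have h1 := hiter (N * (n * n'))
  rw [show (0 : ℤ) + (N * (n * n') : ℕ) * l = 0 + (N * n' * l : ℤ) * n by push_cast; ring,
    show (0 : ℤ) + K * n' + (N * (n * n') : ℕ) * l' = 0 + (K + N * n * l' : ℤ) * n' by
      push_cast; ring, hu.add_mul, hv.add_mul] at h1
  push_cast at h1
  have h2 : (n * l' : ℝ) + 1 ≤ n' * l := by exact_mod_cast hlt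
  have h3 : (0 : ℝ) ≤ N := Nat.cast_nonneg N
  nlinarith

end Comparison

/-! ### Linearization and conjugacy to the affine model -/

section Conjugacy

/-- A fixed point of a functional equation with two monotone inner maps. -/
theorem exists_monotone_solution {α : ℝ} (hα : 0 < α) (hα' : 3 * α < 1) {p q N : ℝ → ℝ}
    (hp : Continuous p) (hq : Continuous q) (hN : Continuous N) (hpm : Monotone p)
    (hqm : Monotone q) (hNm : Monotone N) (hNb : ∀ x, ‖N x‖ ≤ 1) (c : ℝ) :
    ∃ H : ℝ → ℝ, Continuous H ∧ Monotone H ∧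
      ∀ x, H x = N x + α * (H (p x) - H c + H (q x)) := by
  let M := BoundedContinuousFunction.ofNormedAddCommGroup N hN 1 hNb
  let K : BoundedContinuousFunction ℝ ℝ → BoundedContinuousFunction ℝ ℝ := fun H =>
    M + α • (H.compContinuous ⟨p, hp⟩ - BoundedContinuousFunction.const ℝ (H c) +
      H.compContinuous ⟨q, hq⟩)
  have hK : ∀ H x, K H x = N x + α * (H (p x) - H c + H (q x)) := fun H x => rfl
  -- `H` is evaluated three times, each with weight `α`. The term `H c` lets the equation determine
  -- `β = 1 - α * H c` by itself.
  have hC : ContractingWith ⟨3 * α, by positivity⟩ K := by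
    refine ⟨hα', LipschitzWith.of_dist_le_mul fun H G => ?_⟩
    change dist (K H) (K G) ≤ 3 * α * dist H G
    refine (BoundedContinuousFunction.dist_le (by positivity)).2 fun x => ?_
    rw [hK, hK, Real.dist_eq]
    have key : ∀ y, |H y - G y| ≤ dist H G := fun y => by
      rw [← Real.dist_eq]; exact BoundedContinuousFunction.dist_coe_le_dist y
    have h1 := abs_le.1 (key (p x))
    have h2 := abs_le.1 (key (q x))
    have h3 := abs_le.1 (key c)
    rw [show N x + α * (H (p x) - H c + H (q x)) - (N x + α * (G (p x) - G c + G (q x))) =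
      α * ((H (p x) - G (p x)) - (H c - G c) + (H (q x) - G (q x))) by ring, abs_mul,
      abs_of_pos hα, mul_comm 3 α, mul_assoc]
    refine mul_le_mul_of_nonneg_left (abs_le.2 ⟨?_, ?_⟩) hα.le <;> linarith
  have hfix : K (ContractingWith.fixedPoint K hC) = _ := hC.fixedPoint_isFixedPt
  have hclosed : IsClosed {H : BoundedContinuousFunction ℝ ℝ | Monotone H} := by
    have : {H : BoundedContinuousFunction ℝ ℝ | Monotone H} =
        ⋂ x, ⋂ y, ⋂ _ : x ≤ y, {H : BoundedContinuousFunction ℝ ℝ | H x ≤ H y} := by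
      ext H
      simp [Monotone]
    rw [this]
    exact isClosed_iInter fun x => isClosed_iInter fun y => isClosed_iInter fun _ =>
      isClosed_le (continuous_eval_const x) (continuous_eval_const y)
  have hmaps : Set.MapsTo K {H | Monotone H} {H | Monotone H} := by
    intro H hH x y hxy
    rw [hK, hK]
    have h1 := hH (hpm hxy)
    have h2 := hH (hqm hxy)
    have h3 := hNm hxy
    have : α * (H (p x) - H c + H (q x)) ≤ α * (H (p y) - H c + H (q y)) :=
      mul_le_mul_of_nonneg_left (by linarith) hα.le
    linarith
  refine ⟨⇑(ContractingWith.fixedPoint K hC), BoundedContinuousFunction.continuous _, ?_,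
    fun x => ?_⟩
  · exact hclosed.mem_of_tendsto (hC.tendsto_iterate_fixedPoint 0)
      (Filter.Eventually.of_forall fun k => hmaps.iterate k (fun _ _ _ => le_rfl))
  · conv_lhs => rw [← hfix]
    exact hK _ x

variable {g : ℝ → ℝ} {a κ : ℝ}

/-- Projecting onto `[g 0, g a]` before inverting extends the inverse to all of `ℝ`, where the
functional equation is posed. -/
theorem IsContractionOn.exists_leftInverse (F : IsContractionOn g a κ) :
    ∃ γ : ℝ → ℝ, Continuous γ ∧ Monotone γ ∧ ∀ x ∈ Set.Icc 0 a, γ (g x) = x := by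
  have : Set.OrdConnected (Set.range g) := (isPreconnected_range F.cont).ordConnected
  let e := F.mono.orderIso g
  have hle : g 0 ≤ g a := F.mono.monotone F.pos.le
  have hsub : Set.Icc (g 0) (g a) ⊆ Set.range g :=
    this.out ⟨0, rfl⟩ ⟨a, rfl⟩
  let ι : ℝ → Set.range g := fun x => ⟨Set.projIcc (g 0) (g a) hle x, hsub (Subtype.prop _)⟩
  have hι : Continuous ι := Continuous.subtype_mk
    (continuous_subtype_val.comp continuous_projIcc) _
  refine ⟨fun x => e.symm (ι x), e.symm.continuous.comp hι, fun x y hxy => ?_, fun x hx => ?_⟩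
  · exact e.symm.monotone (Set.monotone_projIcc hle hxy)
  · have : ι (g x) = e x := by
      apply Subtype.ext
      change ((Set.projIcc (g 0) (g a) hle (g x) : Set.Icc (g 0) (g a)) : ℝ) = g x
      rw [Set.projIcc_of_mem hle ⟨F.mono.monotone hx.1, F.mono.monotone hx.2⟩]
    simp only [this, OrderIso.symm_apply_apply]

/-- The rotation-like map of `[g c, g c + 1]` is linearized by an increasing function `H`. -/
theorem IsContractionOn.exists_linearization (F : IsContractionOn g a κ) {c α : ℝ}
    (hc : c ∈ Set.Ioo 0 a) (hα : 0 < α) (hα' : 3 * α < 1) :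
    ∃ H : ℝ → ℝ, Continuous H ∧ StrictMonoOn H (Set.Icc (g c) (g c + 1)) ∧ H (g c) = 0 ∧
      H (g c + 1) = 1 ∧
      (∀ x ∈ Set.Icc (g c) (g c + 1), x ≤ c → H (g x + 1) = α * H x + (1 - α * H c)) ∧
      (∀ x ∈ Set.Icc (g c) (g c + 1), c ≤ x → H (g x) = α * H x + (1 - α * H c) - 1) := by
  obtain ⟨γ, hγc, hγm, hγ⟩ := F.exists_leftInverse
  set L := g c with hL
  set R := g c + 1 with hR
  have hL0 : 0 < L := F.apply_pos hc.1
  have hLc : L < c := F.apply_lt hc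
  have hcR : c < R := F.lt_apply_add_one hc
  have hRa : R < a := F.apply_add_one_lt hc.2
  have hgRL : g R < g L + 1 := F.lt_add ⟨hL0.le, by linarith⟩ ⟨by linarith, hRa.le⟩ one_pos le_rfl
  have hgLL : g L < L := F.mono hLc
  have hgcR : L < g R := F.mono hcR
  set w := g L + 1 - g R with hw
  have hw0 : 0 < w := by linarith
  -- `T_c` misses the gap between `g R` and `g L + 1`, and the affine model misses one of length `1
  -- - α`; `N` rises by exactly that across the gap.
  let N : ℝ → ℝ := fun x => (1 - α) * max 0 (min 1 ((x - g R) / w))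
  have hNlo : ∀ x, x ≤ g R → N x = 0 := fun x hx => by
    have : (x - g R) / w ≤ 0 := div_nonpos_of_nonpos_of_nonneg (by linarith) hw0.le
    simp only [N]
    rw [max_eq_left ((min_le_right _ _).trans this), mul_zero]
  have hNhi : ∀ x, g L + 1 ≤ x → N x = 1 - α := fun x hx => by
    have : 1 ≤ (x - g R) / w := by rw [le_div_iff₀ hw0]; linarith
    simp only [N]
    rw [min_eq_left this, max_eq_right zero_le_one, mul_one]
  have hNm : Monotone N := fun x y hxy => by
    have : (x - g R) / w ≤ (y - g R) / w := by gcongr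
    exact mul_le_mul_of_nonneg_left (max_le_max le_rfl (min_le_min le_rfl this)) (by linarith)
  have hNs : ∀ x y, x < y → x < g L + 1 → g R < y → N x < N y := by
    intro x y hxy hx hy
    have h1 : (x - g R) / w < (y - g R) / w := by gcongr
    have h2 : 0 < (y - g R) / w := div_pos (by linarith) hw0
    have h3 : (x - g R) / w < 1 := by rw [div_lt_one hw0]; linarith
    refine mul_lt_mul_of_pos_left ?_ (by linarith)
    refine lt_max_of_lt_right (max_lt (lt_min one_pos h2) (lt_min ?_ ?_))
    · exact (min_le_right _ _).trans_lt h3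
    · exact (min_le_right _ _).trans_lt h1
  have hNb : ∀ x, ‖N x‖ ≤ 1 := fun x => by
    have h0 : 0 ≤ max 0 (min 1 ((x - g R) / w)) := le_max_left _ _
    have h1 : max 0 (min 1 ((x - g R) / w)) ≤ 1 := max_le zero_le_one (min_le_left _ _)
    rw [Real.norm_eq_abs, abs_of_nonneg (mul_nonneg (by linarith) h0)]
    exact mul_le_one₀ (by linarith) h0 h1
  -- Clamped inverses of the upper and lower branch; on the image of either branch the other inverse
  -- is constant.
  let p : ℝ → ℝ := fun x => max c (min R (γ x))
  let q : ℝ → ℝ := fun x => max L (min c (γ (x - 1)))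
  have hpm : Monotone p := fun x y hxy => max_le_max le_rfl (min_le_min le_rfl (hγm hxy))
  have hqm : Monotone q := fun x y hxy =>
    max_le_max le_rfl (min_le_min le_rfl (hγm (by linarith)))
  have hpg : ∀ x, c ≤ x → x ≤ R → p (g x) = x := fun x h1 h2 => by
    simp only [p]
    rw [hγ x ⟨by linarith [hc.1], by linarith⟩, min_eq_right h2, max_eq_right h1]
  have hqg : ∀ x, L ≤ x → x ≤ c → q (g x + 1) = x := fun x h1 h2 => by
    simp only [q]
    rw [add_sub_cancel_right, hγ x ⟨by linarith, by linarith⟩, min_eq_right h2, max_eq_right h1]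
  have hplo : p L = c := hpg c le_rfl hcR.le
  have hphi : ∀ x, g R ≤ x → p x = R := fun x hx =>
    le_antisymm (max_le hcR.le (min_le_left _ _)) (by
      rw [← hpg R hcR.le le_rfl]; exact hpm hx)
  have hqhi : q R = c := hqg c hLc.le le_rfl
  have hqlo : ∀ x, x ≤ g L + 1 → q x = L := fun x hx =>
    le_antisymm (by rw [← hqg L le_rfl hLc.le]; exact hqm hx) (le_max_left _ _)
  obtain ⟨H, hHc, hHm, hH⟩ := exists_monotone_solution hα hα' (p := p) (q := q) (N := N)
    (by fun_prop) (by fun_prop) (by fun_prop) hpm hqm hNm hNb c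
  have hHL : H L = 0 := by
    have := hH L
    rw [hplo, hqlo L (by linarith), hNlo L hgcR.le] at this
    nlinarith
  have hHR : H R = 1 := by
    have := hH R
    rw [hphi R (by linarith), hqhi, hNhi R (by linarith)] at this
    nlinarith
  have hlow : ∀ x ∈ Set.Icc L R, x ≤ c → H (g x + 1) = α * H x + (1 - α * H c) := by
    intro x hx hxc
    have h1 : g L ≤ g x := F.mono.monotone hx.1
    rw [hH, hqg x hx.1 hxc, hphi _ (by linarith), hNhi _ (by linarith), hHR]
    ring
  have hhigh : ∀ x ∈ Set.Icc L R, c ≤ x → H (g x) = α * H x + (1 - α * H c) - 1 := by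
    intro x hx hxc
    have h1 : g x ≤ g R := F.mono.monotone hx.2
    rw [hH, hpg x hxc hx.2, hqlo _ (by linarith), hNlo _ h1, hHL]
    ring
  refine ⟨H, hHc, ?_, hHL, hHR, hlow, hhigh⟩
  -- A flat piece of `H` pulls back to a flat piece, which the branch contracts by `κ`; iterating
  -- forces its length to 0.
  have hexp : ∀ (k : ℕ) (x y : ℝ), L ≤ x → x < y → y ≤ R → H x = H y → y - x ≤ κ ^ k := by
    intro k
    induction k with
    | zero => intro x y h1 _ h2 _; rw [pow_zero]; linarith
    | succ k ih =>
      intro x y hLx hxy hyR hxyH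
      have hN : N y ≤ N x := by
        have h1 := hH x
        have h2 := hH y
        have h3 := hHm (hpm hxy.le)
        have h4 := hHm (hqm hxy.le)
        have : α * (H (p x) - H c + H (q x)) ≤ α * (H (p y) - H c + H (q y)) :=
          mul_le_mul_of_nonneg_left (by linarith) hα.le
        linarith
      -- `N` is strict across the gap, so a flat piece cannot meet it and lies in the range of a
      -- single branch.
      have hout : y ≤ g R ∨ g L + 1 ≤ x := by
        by_contra! h
        exact absurd hN (not_le.2 (hNs x y hxy h.2 h.1))
      have hstep : ∀ x' y' : ℝ, L ≤ x' → y' ≤ R → x' < y' → H x' = H y' →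
          g y' - g x' ≤ κ ^ (k + 1) := by
        intro x' y' h1 h2 h3 h4
        refine (F.sub_le x' y' (by linarith) h3.le (by linarith)).trans ?_
        rw [pow_succ']
        exact mul_le_mul_of_nonneg_left (ih x' y' h1 h3 h2 h4) F.factor_pos.le
      rcases hout with hout | hout
      · obtain ⟨x', hx', rfl⟩ := intermediate_value_Icc hcR.le F.cont.continuousOn
          (show x ∈ Set.Icc (g c) (g R) from ⟨hLx, by linarith⟩)
        obtain ⟨y', hy', rfl⟩ := intermediate_value_Icc hcR.le F.cont.continuousOn
          (show y ∈ Set.Icc (g c) (g R) from ⟨by linarith, hout⟩)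
        have hlt := F.mono.lt_iff_lt.1 hxy
        refine hstep x' y' (by linarith [hx'.1]) hy'.2 hlt ?_
        rw [hhigh x' ⟨by linarith [hx'.1], hx'.2⟩ hx'.1,
          hhigh y' ⟨by linarith [hy'.1], hy'.2⟩ hy'.1] at hxyH
        exact mul_left_cancel₀ hα.ne' (by linarith)
      · obtain ⟨x', hx', hx1⟩ := intermediate_value_Icc hLc.le F.cont.continuousOn
          (show x - 1 ∈ Set.Icc (g L) (g c) from ⟨by linarith, by linarith⟩)
        obtain ⟨y', hy', hy1⟩ := intermediate_value_Icc hLc.le F.cont.continuousOn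
          (show y - 1 ∈ Set.Icc (g L) (g c) from ⟨by linarith, by linarith⟩)
        obtain rfl : x = g x' + 1 := by linarith
        obtain rfl : y = g y' + 1 := by linarith
        have hlt := F.mono.lt_iff_lt.1 (show g x' < g y' by linarith)
        have := hstep x' y' hx'.1 (by linarith [hy'.2]) hlt (by
          rw [hlow x' ⟨hx'.1, by linarith [hx'.2]⟩ hx'.2,
            hlow y' ⟨hy'.1, by linarith [hy'.2]⟩ hy'.2] at hxyH
          exact mul_left_cancel₀ hα.ne' (by linarith))
        linarith
  intro x hx y hy hxy
  refine lt_of_le_of_ne (hHm hxy.le) fun heq => ?_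
  obtain ⟨k, hk⟩ := exists_pow_lt_of_lt_one (sub_pos.2 hxy) F.lt_one
  exact absurd (hexp k x y hx.1 hxy hy.2 heq) (not_le.2 hk)

/-- A linearization of the rotation-like map is a topological conjugacy to `S α β`. -/
theorem IsContractionOn.conjugateOn_S (F : IsContractionOn g a κ) {c α β : ℝ}
    (hc : c ∈ Set.Ioo 0 a) {H : ℝ → ℝ} (hHc : Continuous H)
    (hH : StrictMonoOn H (Set.Icc (g c) (g c + 1))) (hHL : H (g c) = 0) (hHR : H (g c + 1) = 1)
    (hlow : ∀ x ∈ Set.Icc (g c) (g c + 1), x ≤ c → H (g x + 1) = α * H x + β)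
    (hhigh : ∀ x ∈ Set.Icc (g c) (g c + 1), c ≤ x → H (g x) = α * H x + β - 1) :
    NagumoSato.ConjugateOn (NagumoSato.T g c) (Set.Icc (g c) (g c + 1))
      (NagumoSato.S α β) (Set.Icc 0 1) := by
  have hL0 : 0 < g c := F.apply_pos hc.1
  have hLc : g c < c := F.apply_lt hc
  have hcR : c < g c + 1 := F.lt_apply_add_one hc
  have hRa : g c + 1 < a := F.apply_add_one_lt hc.2
  have hT : Set.MapsTo (NagumoSato.T g c) (Set.Icc (g c) (g c + 1)) (Set.Ico (g c) (g c + 1)) := by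
    intro x hx
    unfold NagumoSato.T
    split_ifs with h
    · have h1 := F.mono h
      have h2 := F.lt_add (x := x) (y := c) ⟨by linarith [hx.1], by linarith⟩
        ⟨hc.1.le, hc.2.le⟩ one_pos (by linarith [hx.1])
      exact ⟨by linarith, by linarith⟩
    · have h1 := F.mono.monotone (not_lt.1 h)
      have h2 := F.lt_add (x := c) (y := x) ⟨hc.1.le, hc.2.le⟩ ⟨by linarith, by linarith [hx.2]⟩
        one_pos (by linarith [hx.2])
      exact ⟨h1, h2⟩
  have hmaps : Set.MapsTo H (Set.Icc (g c) (g c + 1)) (Set.Icc 0 1) := by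
    intro x hx
    rw [← hHL, ← hHR]
    exact ⟨hH.monotoneOn ⟨le_rfl, by linarith⟩ hx hx.1,
      hH.monotoneOn hx ⟨by linarith, le_rfl⟩ hx.2⟩
  have hS : Set.MapsTo (NagumoSato.S α β) (Set.Icc 0 1) (Set.Icc 0 1) := fun x _ =>
    ⟨Int.fract_nonneg _, (Int.fract_lt_one _).le⟩
  let h : Set.Icc (g c) (g c + 1) → Set.Icc (0 : ℝ) 1 := hmaps.restrict H _ _
  have hmono : StrictMono h := fun x y hxy => hH x.2 y.2 hxy
  have hsurj : Function.Surjective h := by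
    rintro ⟨y, hy⟩
    obtain ⟨x, hx, hxy⟩ := intermediate_value_Icc (by linarith : g c ≤ g c + 1) hHc.continuousOn
      (show y ∈ Set.Icc (H (g c)) (H (g c + 1)) by rwa [hHL, hHR])
    exact ⟨⟨x, hx⟩, Subtype.ext hxy⟩
  refine ⟨hT.mono_right Set.Ico_subset_Icc_self, hS,
    (hmono.orderIsoOfSurjective h hsurj).toHomeomorph, fun x => Subtype.ext ?_⟩
  obtain ⟨x, hx⟩ := x
  change H (NagumoSato.T g c x) = Int.fract (α * H x + β)
  have hTx := hT hx
  have h0 := (hmaps (Set.Ico_subset_Icc_self hTx)).1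
  have h1 : H (NagumoSato.T g c x) < 1 := by
    rw [← hHR]
    exact hH (Set.Ico_subset_Icc_self hTx) ⟨by linarith, le_rfl⟩ hTx.2
  symm
  rw [Int.fract_eq_iff]
  refine ⟨h0, h1, ?_⟩
  unfold NagumoSato.T
  split_ifs with hxc
  · exact ⟨0, by rw [hlow x hx hxc.le]; simp⟩
  · exact ⟨1, by rw [hhigh x hx (not_lt.1 hxc)]; push_cast; ring⟩

end Conjugacy

/-! ### Periodic points of the affine model and the region `D` -/

section Parameters

/-- The number of wraps of the rotation by `l / n` started at `s`, at the `m`-th step. -/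
def wrapCount (n l : ℕ) (s m : ℤ) : ℤ := ((m + 1) * l + s) / n - (m * l + s) / n

theorem k_eq_wrapCount (n l : ℕ) (m : ℤ) : NagumoSato.k n l m = wrapCount n l 0 m := by
  simp only [NagumoSato.k, wrapCount, Rat.floor_intCast_div_natCast, add_zero]

/-- Periodic points of a piecewise affine rotation-like map, in closed form. -/
theorem periodic_affine_eq {n l : ℕ} (hn : 0 < n) {α β : ℝ} {y : ℤ → ℝ}
    (hy : ∀ r : ℤ, 0 ≤ r → r < n → y ((r + l) % n) = α * y r + β - ((r + l) / n : ℤ)) (s : ℤ) :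
    (1 - α) * (y (s % n) * (1 - α ^ n)) = β * (1 - α ^ n) -
      (1 - α) * ∑ j ∈ Finset.range n, α ^ j * (wrapCount n l s (n - 1 - j) : ℝ) := by
  have hn' : (0 : ℤ) < n := by exact_mod_cast hn
  -- Variation of constants along the orbit; at `N = n` it closes up and can be solved for `y (s %
  -- n)`.
  have hiter : ∀ N : ℕ, y ((N * l + s) % n) =
      α ^ N * y (s % n) + ∑ m ∈ Finset.range N, α ^ (N - 1 - m) * (β - wrapCount n l s m) := by
    intro N
    induction N with
    | zero => simp
    | succ N ih =>
      have h0 := Int.emod_nonneg (N * l + s) hn'.ne'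
      have h1 := Int.emod_lt_of_pos (N * l + s) hn'
      have h2 : ((N * l + s) % n + l) / n = wrapCount n l s N := by
        have h3 := Int.emod_add_mul_ediv (N * l + s) n
        have h4 : ((N + 1) * l + s : ℤ) = ((N * l + s) % n + l) + n * ((N * l + s) / n) := by
          linarith
        rw [wrapCount, h4, Int.add_mul_ediv_left _ _ hn'.ne', add_sub_cancel_right]
      have h5 := hy _ h0 h1
      rw [Int.emod_add_emod, h2, ih] at h5
      rw [show ((N + 1 : ℕ) : ℤ) * l + s = N * l + s + l by push_cast; ring, h5,
        Finset.sum_range_succ, mul_add, Finset.mul_sum]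
      have h6 : ∀ m ∈ Finset.range N, α * (α ^ (N - 1 - m) * (β - wrapCount n l s m)) =
          α ^ (N + 1 - 1 - m) * (β - wrapCount n l s m) := by
        intro m hm
        have : N + 1 - 1 - m = (N - 1 - m) + 1 := by have := Finset.mem_range.1 hm; omega
        rw [this, pow_succ]; ring
      rw [Finset.sum_congr rfl h6, Nat.add_sub_cancel, Nat.sub_self]
      ring
  have h := hiter n
  have hmod : ((n : ℤ) * l + s) % n = s % n := by simp
  rw [hmod, ← Finset.sum_range_reflect] at h
  have hsum : ∀ j ∈ Finset.range n,
      α ^ (n - 1 - (n - 1 - j)) * (β - (wrapCount n l s ((n - 1 - j : ℕ) : ℤ) : ℝ)) =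
        α ^ j * β - α ^ j * (wrapCount n l s (n - 1 - j) : ℝ) := by
    intro j hj
    have hj' := Finset.mem_range.1 hj
    rw [show n - 1 - (n - 1 - j) = j by omega, show ((n - 1 - j : ℕ) : ℤ) = n - 1 - j by omega,
      mul_sub]
  rw [Finset.sum_congr rfl hsum, Finset.sum_sub_distrib, ← Finset.sum_mul] at h
  have hgeom := mul_neg_geom_sum α n
  linear_combination (1 - α) * h + β * hgeom

/-- Since `⌊(-b - 1) / n⌋ = -1 - ⌊b / n⌋` without exception, time reversal exchanges the starts `-1`
and `0`. This treats the top point of the orbit. -/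
theorem wrapCount_neg_one_reflect {n : ℕ} (l : ℕ) (hn : 0 < n) (j : ℤ) :
    wrapCount n l (-1) (n - 1 - j) = wrapCount n l 0 j := by
  have hn' : (0 : ℤ) < n := by exact_mod_cast hn
  have key : ∀ b : ℤ, (-b - 1) / n = -1 - b / n := by
    intro b
    have h0 := Int.emod_nonneg b hn'.ne'
    have h1 := Int.emod_lt_of_pos b hn'
    have h2 := Int.emod_add_mul_ediv b n
    rw [show -b - 1 = (n - 1 - b % n) + n * (-1 - b / n) by linarith,
      Int.add_mul_ediv_left _ _ hn'.ne', Int.ediv_eq_zero_of_lt (by omega) (by omega), zero_add]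
  unfold wrapCount
  rw [show ((n - 1 - j + 1) * l + -1 : ℤ) = (-(j * l) - 1) + n * l by ring,
    show ((n - 1 - j) * l + -1 : ℤ) = (-((j + 1) * l) - 1) + n * l by ring,
    Int.add_mul_ediv_left _ _ hn'.ne', Int.add_mul_ediv_left _ _ hn'.ne', key, key, add_zero,
    add_zero]
  ring

/-- Here `⌊-b / n⌋ = -1 - ⌊b / n⌋` fails when `n ∣ b`, which by coprimality affects only `j = 0` and
`j = n - 1`. These two corrections separate `BL` from `BU`. -/
theorem wrapCount_zero_reflect {n l : ℕ} (hn : 2 ≤ n) (hnl : Nat.Coprime n l) {j : ℕ}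
    (hj : j < n) : wrapCount n l 0 (n - 1 - j) =
      wrapCount n l 0 j + (if j = 0 then 1 else 0) - (if j = n - 1 then 1 else 0) := by
  have hn' : (0 : ℤ) < n := by omega
  have key : ∀ i : ℕ, 0 < i → i < n → (-((i : ℤ) * l)) / n = -1 - (i * l) / n := by
    intro i hi0 hin
    have h0 := Int.emod_nonneg ((i : ℤ) * l) hn'.ne'
    have h1 := Int.emod_lt_of_pos ((i : ℤ) * l) hn'
    have h2 := Int.emod_add_mul_ediv ((i : ℤ) * l) n
    have h3 : ((i : ℤ) * l) % n ≠ 0 := by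
      intro h
      have h4 : n ∣ i * l := by exact_mod_cast Int.dvd_of_emod_eq_zero h
      exact absurd (Nat.le_of_dvd hi0 (hnl.dvd_of_dvd_mul_right h4)) (by omega)
    rw [show -((i : ℤ) * l) = (n - (i * l) % n) + n * (-1 - (i * l) / n) by linarith,
      Int.add_mul_ediv_left _ _ hn'.ne', Int.ediv_eq_zero_of_lt (by omega) (by omega), zero_add]
  unfold wrapCount
  rw [show ((n - 1 - j + 1) * l + 0 : ℤ) = -(j * l) + n * l by ring,
    show ((n - 1 - j) * l + 0 : ℤ) = -(((j + 1 : ℕ) : ℤ) * l) + n * l by push_cast; ring,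
    Int.add_mul_ediv_left _ _ hn'.ne', Int.add_mul_ediv_left _ _ hn'.ne', add_zero, add_zero]
  rcases Nat.eq_zero_or_pos j with h0 | h0
  · subst h0
    rw [if_pos rfl, if_neg (by omega), key 1 one_pos (by omega)]
    simp
  · rw [if_neg (by omega), key j h0 hj]
    rcases eq_or_ne j (n - 1) with h1 | h1
    · rw [if_pos h1]
      have h2 : ((j + 1 : ℕ) : ℤ) = n := by omega
      have h3 : (j : ℤ) + 1 = n := by omega
      rw [h2, h3, ← mul_neg, Int.mul_ediv_cancel_left _ hn'.ne', Int.mul_ediv_cancel_left _ hn'.ne']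
      ring
    · rw [if_neg h1, key (j + 1) (by omega) (by omega)]
      push_cast
      ring

theorem sum_range_k_eq {n l : ℕ} (hl : l < n) (α : ℝ) :
    ∑ j ∈ Finset.range n, α ^ j * (wrapCount n l 0 j : ℝ) =
      ∑ m ∈ Finset.Icc 1 (n - 1), (NagumoSato.k n l m : ℝ) * α ^ m := by
  -- As `l < n`, no wrap occurs at time 0, so the sum may start at 1.
  have h0 : wrapCount n l 0 0 = 0 := by
    simp only [wrapCount, zero_add, one_mul, add_zero, zero_mul, Int.zero_ediv, sub_zero]
    exact Int.ediv_eq_zero_of_lt (by omega) (by omega)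
  have h1 : Finset.Ico 1 n = Finset.Icc 1 (n - 1) := by
    ext m; simp only [Finset.mem_Ico, Finset.mem_Icc]; omega
  rw [Finset.range_eq_Ico, Finset.sum_eq_sum_Ico_succ_bot (by omega), zero_add, h1]
  simp only [Nat.cast_zero, h0, Int.cast_zero, mul_zero, zero_add]
  exact Finset.sum_congr rfl fun m _ => by rw [k_eq_wrapCount, mul_comm]

/-- The closed form at the bottom point reads `(1 - α) * y 0 = β - BL`. -/
theorem BL_lt_of_pos {n l : ℕ} (hn : 2 ≤ n) (hl : l < n) (hnl : Nat.Coprime n l) {α β : ℝ}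
    (hα : α ∈ Set.Ioo 0 1) {y : ℤ → ℝ}
    (hy : ∀ r : ℤ, 0 ≤ r → r < n → y ((r + l) % n) = α * y r + β - ((r + l) / n : ℤ))
    (hpos : 0 < y 0) : NagumoSato.BL n l α < β := by
  have h := periodic_affine_eq (by omega) hy 0
  have hsum : ∀ j ∈ Finset.range n, α ^ j * (wrapCount n l 0 (n - 1 - j) : ℝ) =
      α ^ j * (wrapCount n l 0 j : ℝ) + (if j = 0 then α ^ j else 0) -
        (if j = n - 1 then α ^ j else 0) := by
    intro j hj
    rw [wrapCount_zero_reflect hn hnl (Finset.mem_range.1 hj)]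
    split_ifs <;> push_cast <;> ring
  rw [Finset.sum_congr rfl hsum, Finset.sum_sub_distrib, Finset.sum_add_distrib,
    sum_range_k_eq hl, Finset.sum_ite_eq', Finset.sum_ite_eq', if_pos (by simp; omega),
    if_pos (by simp; omega), Int.zero_emod, pow_zero] at h
  have hq : 0 < 1 - α ^ n := sub_pos.2 (pow_lt_one₀ hα.1.le hα.2 (by omega))
  have hp : 0 < (1 - α) * (y 0 * (1 - α ^ n)) := by
    have := sub_pos.2 hα.2
    positivity
  unfold NagumoSato.BL
  set A := ∑ m ∈ Finset.Icc 1 (n - 1), (NagumoSato.k n l m : ℝ) * α ^ m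
  rw [show (1 - α) * (1 / (1 - α ^ n) * A + 1 - (α ^ (n - 1) - α ^ n) / (1 - α ^ n)) =
    (1 - α) * (A + 1 - α ^ (n - 1)) / (1 - α ^ n) by field_simp; ring, div_lt_iff₀ hq]
  linarith

/-- The closed form at the top point, indexed by `-1` mod `n`, reads `(1 - α) * (1 - y (n - 1)) = BU
- β`. -/
theorem lt_BU_of_lt_one {n l : ℕ} (hl : l < n) {α β : ℝ}
    (hα : α ∈ Set.Ioo 0 1) {y : ℤ → ℝ}
    (hy : ∀ r : ℤ, 0 ≤ r → r < n → y ((r + l) % n) = α * y r + β - ((r + l) / n : ℤ))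
    (hlt : y (n - 1) < 1) : β < NagumoSato.BU n l α := by
  have h := periodic_affine_eq (by omega) hy (-1)
  have hmod : (-1 : ℤ) % n = n - 1 := by
    rw [← Int.add_emod_right, Int.emod_eq_of_lt (by omega) (by omega)]; ring
  simp only [wrapCount_neg_one_reflect l (show 0 < n by omega)] at h
  rw [sum_range_k_eq hl, hmod] at h
  have hq : 0 < 1 - α ^ n := sub_pos.2 (pow_lt_one₀ hα.1.le hα.2 (by omega))
  have hp : 0 < (1 - α) * ((1 - y (n - 1)) * (1 - α ^ n)) := by
    have := sub_pos.2 hα.2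
    have := sub_pos.2 hlt
    positivity
  unfold NagumoSato.BU
  set A := ∑ m ∈ Finset.Icc 1 (n - 1), (NagumoSato.k n l m : ℝ) * α ^ m
  rw [show (1 - α) * (1 / (1 - α ^ n) * A + 1) = (1 - α) * (A + (1 - α ^ n)) / (1 - α ^ n) by
    field_simp, lt_div_iff₀ hq]
  linarith

theorem mem_interior_D {n l : ℕ} (hn : 0 < n) {α β : ℝ} (hα : α ∈ Set.Ioo 0 1)
    (hβ : β ∈ Set.Ioo 0 1) (hL : NagumoSato.BL n l α < β) (hU : β < NagumoSato.BU n l α) :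
    (α, β) ∈ interior (NagumoSato.D n l) := by
  have hq : 1 - α ^ n ≠ 0 := (sub_pos.2 (pow_lt_one₀ hα.1.le hα.2 hn.ne')).ne'
  have hcL : ContinuousAt (fun p : ℝ × ℝ => NagumoSato.BL n l p.1) (α, β) := by
    unfold NagumoSato.BL
    fun_prop (disch := exact hq)
  have hcU : ContinuousAt (fun p : ℝ × ℝ => NagumoSato.BU n l p.1) (α, β) := by
    unfold NagumoSato.BU
    fun_prop (disch := exact hq)
  rw [mem_interior_iff_mem_nhds]
  filter_upwards [hcL.eventually_lt continuousAt_snd hL, continuousAt_snd.eventually_lt hcU hU,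
    continuousAt_fst.eventually (isOpen_Ioo.mem_nhds hα),
    continuousAt_snd.eventually (isOpen_Ioo.mem_nhds hβ)] with p h1 h2 h3 h4
  exact ⟨h3, h4, h1.le, h2⟩

end Parameters

/-! ### Conjugacy inside a phase-locking interval -/

section PhaseLocking

variable {g : ℝ → ℝ} {a κ : ℝ}

/-- Inside a phase-locking interval the map is conjugate to some `S α β` with `(α, β)` in the
interior of the corresponding region. -/
theorem IsRotationOrbit.exists_conjugateOn (F : IsContractionOn g a κ) {n l : ℕ} {u : ℤ → ℝ}
    (hu : IsRotationOrbit g a n l u) (hl0 : 0 < l) (hl : l < n) (hnl : Nat.Coprime n l) {c : ℝ}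
    (hc : c ∈ Set.Ioo (u (n - l - 1)) (u (n - l))) :
    ∃ α β : ℝ, (α, β) ∈ interior (NagumoSato.D n l) ∧
      NagumoSato.ConjugateOn (NagumoSato.T g c) (Set.Icc (g c) (g c + 1))
        (NagumoSato.S α β) (Set.Icc 0 1) := by
  have hca : c ∈ Set.Ioo 0 a :=
    ⟨(hu.mem (n - l - 1) (by omega) (by omega)).1.trans hc.1,
      hc.2.trans (hu.mem (n - l) (by omega) (by omega)).2⟩
  -- Any `α` in `(0, 1/3)` would do.
  obtain ⟨H, hHc, hH, hHL, hHR, hlow, hhigh⟩ :=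
    F.exists_linearization hca (α := 1 / 4) (by norm_num) (by norm_num)
  set α : ℝ := 1 / 4 with hα
  set β : ℝ := 1 - α * H c with hβ
  have hα01 : α ∈ Set.Ioo (0 : ℝ) 1 := by rw [hα]; norm_num
  have hLc : g c < c := F.apply_lt hca
  have hcR : c < g c + 1 := F.lt_apply_add_one hca
  have hHc0 : 0 < H c := by
    rw [← hHL]; exact hH ⟨le_rfl, by linarith⟩ ⟨hLc.le, hcR.le⟩ hLc
  have hHc1 : H c < 1 := by
    rw [← hHR]; exact hH ⟨hLc.le, hcR.le⟩ ⟨by linarith, le_rfl⟩ hcR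
  have hβ01 : β ∈ Set.Ioo (0 : ℝ) 1 := by
    rw [hβ, hα]; constructor <;> linarith
  -- The strict position of `c` keeps the orbit off both ends of `[g c, g c + 1]`, hence `(α, β)`
  -- off the boundary of `D`.
  have hbot : g c < u 0 := by
    have e := hu.step (n - l) (by omega) (by omega)
    have e' := hu.add_period 0
    rw [show (n - l : ℤ) + l = 0 + n by ring, e'] at e
    linarith [F.mono hc.2]
  have htop : u (n - 1) < g c + 1 := by
    have e := hu.step (n - l - 1) (by omega) (by omega)
    rw [show (n - l - 1 : ℤ) + l = n - 1 by ring] at e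
    linarith [F.mono hc.1]
  have hmem : ∀ r : ℤ, 0 ≤ r → r < n → u r ∈ Set.Icc (g c) (g c + 1) := fun r h0 h1 =>
    ⟨hbot.le.trans (hu.mono.monotone h0),
      (hu.mono.monotone (show r ≤ n - 1 by omega)).trans htop.le⟩
  have hy : ∀ r : ℤ, 0 ≤ r → r < n →
      H (u ((r + l) % n)) = α * H (u r) + β - ((r + l) / n : ℤ) := by
    intro r h0 h1
    rcases lt_or_ge (r + l) n with h2 | h2
    · rw [Int.emod_eq_of_lt (by omega) h2, Int.ediv_eq_zero_of_lt (by omega) h2,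
        hu.step r h0 h1, Int.cast_zero, sub_zero]
      exact hlow _ (hmem r h0 h1) ((hu.mono.monotone (by omega)).trans hc.1.le)
    · have e1 : (r + l) % n = r + l - n := by
        rw [← Int.sub_emod_right, Int.emod_eq_of_lt (by omega) (by omega)]
      have e2 : (r + l) / n = 1 := by
        have := Int.emod_add_mul_ediv (r + l) n
        rw [e1] at this
        exact mul_left_cancel₀ (show (n : ℤ) ≠ 0 by omega) (by linarith)
      have e3 := hu.add_period (r + l - n)
      rw [sub_add_cancel, hu.step r h0 h1] at e3
      rw [e1, e2, ← add_right_cancel e3, Int.cast_one]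
      exact hhigh _ (hmem r h0 h1) (hc.2.le.trans (hu.mono.monotone (by omega)))
  refine ⟨α, β, mem_interior_D (by omega) hα01 hβ01 ?_ ?_,
    F.conjugateOn_S hca hHc hH hHL hHR hlow hhigh⟩
  · refine BL_lt_of_pos (y := fun r => H (u r)) (by omega) hl hnl hα01 hy ?_
    rw [← hHL]
    exact hH ⟨le_rfl, by linarith⟩ (hmem 0 le_rfl (by omega)) hbot
  · refine lt_BU_of_lt_one (y := fun r => H (u r)) hl hα01 hy ?_
    rw [← hHR]
    exact hH (hmem _ (by omega) (by omega)) ⟨by linarith, le_rfl⟩ htop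

end PhaseLocking

/-! ### Farey neighbours and the main theorem -/

theorem coprime_of_farey {n l n' l' : ℕ} (h : (n' : ℤ) * l - n * l' = 1) : Nat.Coprime n l := by
  rw [← Nat.isCoprime_iff_coprime]
  exact ⟨-l', n', by linarith⟩

theorem coprime_of_farey' {n l n' l' : ℕ} (h : (n' : ℤ) * l - n * l' = 1) :
    Nat.Coprime n' l' := by
  rw [← Nat.isCoprime_iff_coprime]
  exact ⟨l, -n, by linarith⟩

theorem pos_of_coprime {n l : ℕ} (hn : 2 ≤ n) (hnl : Nat.Coprime n l) : 0 < l := by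
  rcases Nat.eq_zero_or_pos l with rfl | h
  · rw [Nat.coprime_zero_right] at hnl; omega
  · exact h

theorem theorem4p2 (g : ℝ → ℝ) (cstar : ℝ) (hcstar : 0 < cstar)
    (hg_cont : Continuous g) (hg_mono : StrictMono g)
    (hg_zero : g 0 = 0) (hg_cstar : g cstar + 1 = cstar)
    (hg_contr : ∃ κ : ℝ, κ < 1 ∧ ∀ x ∈ Set.Ioo 0 cstar, ∀ y ∈ Set.Ioo 0 cstar,
      |g x - g y| ≤ κ * |x - y|) :
    ∃ cL cR : ℕ → ℕ → ℝ,
      (∀ n l : ℕ, 2 ≤ n → l < n → Nat.Coprime n l →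
        cL n l ∈ Set.Ioo 0 cstar ∧ cR n l ∈ Set.Ioo 0 cstar ∧ cL n l < cR n l ∧
        ∀ c ∈ Set.Ioo (cL n l) (cR n l),
          ∃ α β : ℝ, (α, β) ∈ interior (NagumoSato.D n l) ∧
            NagumoSato.ConjugateOn (NagumoSato.T g c) (Set.Icc (g c) (g c + 1))
              (NagumoSato.S α β) (Set.Icc 0 1)) ∧
      (∀ n l n' l' : ℕ, 2 ≤ n → l < n → Nat.Coprime n l → 2 ≤ n' → l' < n' → Nat.Coprime n' l' →
        (n' : ℤ) * l - n * l' = 1 →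
          cR n l < cL (n + n') (l + l') ∧ cL (n + n') (l + l') < cR (n + n') (l + l') ∧
          cR (n + n') (l + l') < cL n' l') := by
  obtain ⟨κ, hκ, hcontr⟩ := hg_contr
  have F := IsContractionOn.of_Ioo hcstar hg_cont hg_mono hg_zero hg_cstar hκ hcontr
  have hex : ∀ n l : ℕ, ∃ u : ℤ → ℝ, 2 ≤ n → l < n → Nat.Coprime n l →
      IsRotationOrbit g cstar n l u := by
    intro n l
    by_cases h : 2 ≤ n ∧ l < n ∧ Nat.Coprime n l
    · obtain ⟨u, hu⟩ := F.exists_rotationOrbit (pos_of_coprime h.1 h.2.2) h.2.1 h.2.2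
      exact ⟨u, fun _ _ _ => hu⟩
    · exact ⟨0, fun h1 h2 h3 => absurd ⟨h1, h2, h3⟩ h⟩
  choose u hu using hex
  let cL : ℕ → ℕ → ℝ := fun n l => u n l (n - l - 1)
  let cR : ℕ → ℕ → ℝ := fun n l => u n l (n - l)
  have hLR : ∀ n l : ℕ, 2 ≤ n → l < n → Nat.Coprime n l → cL n l < cR n l :=
    fun n l h1 h2 h3 => (hu n l h1 h2 h3).mono (by omega)
  have hle : ∀ n l n' l' : ℕ, 2 ≤ n → l < n → 2 ≤ n' → l' < n' →
      (n' : ℤ) * l - n * l' = 1 → cR n l ≤ cL n' l' := by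
    intro n l n' l' h1 h2 h3 h4 h
    have hc := coprime_of_farey h
    have hc' := coprime_of_farey' h
    exact (hu n l h1 h2 hc).le_of_lt F (hu n' l' h3 h4 hc') (pos_of_coprime h1 hc) h2
      (pos_of_coprime h3 hc') h4 (by zify; linarith)
  -- The mediant is a Farey neighbour of both fractions, and its interval has positive length.
  have hlt : ∀ n l n' l' : ℕ, 2 ≤ n → l < n → 2 ≤ n' → l' < n' →
      (n' : ℤ) * l - n * l' = 1 → cR n l < cL n' l' := by
    intro n l n' l' h1 h2 h3 h4 h
    have e1 : ((n + n' : ℕ) : ℤ) * l - n * (l + l' : ℕ) = 1 := by push_cast; linarith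
    have e2 : (n' : ℤ) * (l + l' : ℕ) - (n + n' : ℕ) * l' = 1 := by push_cast; linarith
    exact (hle n l _ _ h1 h2 (by omega) (by omega) e1).trans_lt
      ((hLR _ _ (by omega) (by omega) (coprime_of_farey e2)).trans_le
        (hle _ _ n' l' (by omega) (by omega) h3 h4 e2))
  refine ⟨cL, cR, fun n l h1 h2 h3 => ?_, fun n l n' l' h1 h2 _ h3 h4 _ h => ?_⟩
  · have hl0 := pos_of_coprime h1 h3
    have U := hu n l h1 h2 h3
    exact ⟨U.mem _ (by omega) (by omega), U.mem _ (by omega) (by omega), hLR n l h1 h2 h3,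
      fun c hc => U.exists_conjugateOn F hl0 h2 h3 hc⟩
  · have e1 : ((n + n' : ℕ) : ℤ) * l - n * (l + l' : ℕ) = 1 := by push_cast; linarith
    have e2 : (n' : ℤ) * (l + l' : ℕ) - (n + n' : ℕ) * l' = 1 := by push_cast; linarith
    exact ⟨hlt n l _ _ h1 h2 (by omega) (by omega) e1,
      hLR _ _ (by omega) (by omega) (coprime_of_farey e2),
      hlt _ _ n' l' (by omega) (by omega) h3 h4 e2⟩
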